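/- Notation. For an integer $x$ put $\epsilon_x=(-1)^x$; for an integer $k\ge 0$ put $A_k(t)=\sum_{j=0}^{k-1}\epsilon_j t^{k-1-j}=\dfrac{t^k+\epsilon_{k-1}}{t+1}$, so $A_0=0$. For $f\in\mathbb Z[t]$ let $[f]_j$ be the coefficient of $t^j$ in $f$ (zero for $j<0$). Call $f$ an AC (alternating coefficient) polynomial if $f\ne 0$ and $[f]_j[f]_{j+1}<0$ for all $j$ with $\min\deg f\le j<\deg f$. For a braid word $\beta$ let $w(\beta)$ be its exponent sum, $\widehat\beta$ its closure, and $V_{\widehat\beta}(t)\in\mathbb Z[t^{\pm 1/2}]$ the Jones polynomial, normalised by $V_{\mathrm{unknot}}=1$ and $t^{-1}V_{D_+}-tV_{D_-}=(t^{1/2}-t^{-1/2})V_{D_0}$, the generators $\sigma_i$ being positive crossings. Proposition. Let $\beta=\prod_{j=1}^{r}\sigma_1^{a_j}\sigma_2^{b_j}$ be a positive 3-braid word with $r\ge 1$ and all $a_j,b_j>0$, and let $w=w(\beta)$. Then $$V_{\widehat\beta}(t)=t^{(w-2)/2}\,V^*(t),\qquad V^*\in\mathbb Z[t],\quad \deg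 V^*\le w,$$ $$V^*(t)=\epsilon_w(1+t^2)+t^2\,V^{**}(t),\qquad V^{**}\in\mathbb Z[t].$$ Furthermore $\epsilon_w t^w V^{**}(1/t)=t^2V^{**}(t)$, or equivalently $[V^{**}]_j=\epsilon_w[V^{**}]_{w-j-2}$ for all integers $j$. When $r=1$, $V^{**}$ is zero or an AC polynomial, except in the case $a_1=b_1=2$ (where $V^{**}=1+t^2$), and, with the zero polynomial having no degree: 1. $V^{**}=0$ exactly when $\{a_1,b_1\}=\{1,2\}$; 2. $\deg V^{**}=w-3$ exactly when $\min(a_1,b_1)=1$ and $\max(a_1,b_1)\ge 3$, in which case $V^{**}=-t\,A_{w-3}$; 3. $\deg V^{**}=w-2$ exactly when $a_1=b_1=1$ or $a_1,b_1\ge 2$; in the first case $V^{**}=-1$, in the second $V^{**}=\epsilon_w+\epsilon_{b_1}t\,A_{a_1-2}+\epsilon_{a_1}t\,A_{b_1-2}+t^2A_{a_1-1}A_{b_1-1}$; 4. if $w\ge 4$, every non-zero coefficient $[V^{**}]_j$ has the sign $\epsilon_{j+w}$. When $r\ge 2$, $\deg V^{**}\le w-3$ (this includes the case $V^{**}=0$).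 -/

import Mathlib

open Polynomial LaurentPolynomial

noncomputable section

namespace ThreeBraidJones

/-- A letter `σ_{i+1}` (if `positive`) or `σ_{i+1}⁻¹` (otherwise) of a braid word on `n + 1`
strands; it is a crossing between the strands in the positions `i` and `i + 1` (counted from `0`). -/
structure Letter (n : ℕ) where
  index : Fin n
  positive : Bool

/-- A braid word on `n + 1` strands. -/
abbrev BraidWord (n : ℕ) := List (Letter n)

/-- The writhe, that is, the exponent sum of a braid word. -/
def writhe {n : ℕ} (β : BraidWord n) : ℤ :=
  (β.map fun l => if l.positive then (1 : ℤ) else -1).sum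

/-- A Kauffman state of the closed braid diagram: each crossing gets an `A`-smoothing (`true`) or
a `B`-smoothing (`false`). -/
abbrev KauffmanState {n : ℕ} (β : BraidWord n) := Fin β.length → Bool

/-- The standard diagram of the closure of `β` is cut by horizontal levels `0, …, β.length`, the
`k`-th letter lying between the levels `k` and `k + 1`. The points of the diagram on these levels
are the pairs (level, position). -/
abbrev LevelPoint {n : ℕ} (β : BraidWord n) := Fin (β.length + 1) × Fin (n + 1)

/-- The elementary arcs of the smoothed diagram. All strands are oriented upwards, so that the
`A`-smoothing of a positive crossing and the `B`-smoothing of a negative crossing are the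
smoothing into two vertical arcs; the other two smoothings give a cup and a cap. -/
inductive StateArc {n : ℕ} (β : BraidWord n) (s : KauffmanState β) :
    LevelPoint β → LevelPoint β → Prop
  /-- a strand that passes by the `k`-th crossing -/
  | strand (k : Fin β.length) (p : Fin (n + 1))
      (h₁ : p ≠ (β.get k).index.castSucc) (h₂ : p ≠ (β.get k).index.succ) :
      StateArc β s (k.castSucc, p) (k.succ, p)
  | vertical_left (k : Fin β.length) (h : s k = (β.get k).positive) :
      StateArc β s (k.castSucc, (β.get k).index.castSucc) (k.succ, (β.get k).index.castSucc)
  | vertical_right (k : Fin β.length) (h : s k = (β.get k).positive) :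
      StateArc β s (k.castSucc, (β.get k).index.succ) (k.succ, (β.get k).index.succ)
  | horizontal_bottom (k : Fin β.length) (h : s k ≠ (β.get k).positive) :
      StateArc β s (k.castSucc, (β.get k).index.castSucc) (k.castSucc, (β.get k).index.succ)
  | horizontal_top (k : Fin β.length) (h : s k ≠ (β.get k).positive) :
      StateArc β s (k.succ, (β.get k).index.castSucc) (k.succ, (β.get k).index.succ)
  /-- the closing strands -/
  | closing (p : Fin (n + 1)) : StateArc β s (0, p) (Fin.last β.length, p)

/-- The number of circles of the smoothed diagram: the number of classes of points under the
equivalence relation generated by the elementary arcs. -/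
def loopCount {n : ℕ} (β : BraidWord n) (s : KauffmanState β) : ℕ :=
  Nat.card (Quot (StateArc β s))

/-- The Kauffman bracket of the standard diagram of the closure of `β`, in the variable `A = T 1`,
normalised to be `1` on the circle:
`∑ₛ A ^ (#A - #B) * (-A² - A⁻²) ^ (#circles - 1)`. -/
def kauffmanBracket {n : ℕ} (β : BraidWord n) : ℤ[T;T⁻¹] :=
  ∑ s : KauffmanState β,
    T (∑ k, if s k then (1 : ℤ) else -1) * (-T 2 - T (-2)) ^ (loopCount β s - 1)

/-- The Jones polynomial of the closure of `β`, as a Laurent polynomial in the variable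
`T 1 = t^{1/4}`, so that `T 2 = √t` and `T 4 = t`. It is `(-A³)^{-writhe}` times the bracket at
`A = t^{-1/4}`; this is the normalisation with `V = 1` on the unknot and
`t⁻¹ V₊ - t V₋ = (t^{1/2} - t^{-1/2}) V₀`. -/
def jones {n : ℕ} (β : BraidWord n) : ℤ[T;T⁻¹] :=
  invert (LaurentPolynomial.C ((writhe β).negOnePow : ℤ) * T (-3 * writhe β) * kauffmanBracket β)

/-- The positive 3-braid word `∏_j σ₁ ^ (a j) σ₂ ^ (b j)`. -/
def positiveWord {r : ℕ} (a b : Fin r → ℕ) : BraidWord 2 :=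
  (List.ofFn fun j =>
    List.replicate (a j) (⟨0, true⟩ : Letter 2) ++ List.replicate (b j) ⟨1, true⟩).flatten

/-- The image in `ℤ[t^{±1/4}]` of a polynomial in `t`; here `t` is sent to `T 4`. -/
def inQuarterPower (f : ℤ[X]) : ℤ[T;T⁻¹] := aeval (T 4 : ℤ[T;T⁻¹]) f

/-- The polynomial `A_w = (t^w + (-1)^{w-1}) / (t + 1)`, for `w ≥ 0`. -/
def altPoly (w : ℕ) : ℤ[X] :=
  ∑ j ∈ Finset.range w, Polynomial.C ((-1 : ℤ) ^ j) * X ^ (w - 1 - j)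

theorem altPoly_mul (w : ℕ) :
    (X + 1) * altPoly w = X ^ w - Polynomial.C ((-1 : ℤ) ^ w) := by
  induction w with
  | zero => simp [altPoly]
  | succ w ih =>
    have h : altPoly (w + 1) = X ^ w - altPoly w := by
      unfold altPoly
      rw [Finset.sum_range_succ', sub_eq_add_neg, add_comm, ← Finset.sum_neg_distrib]
      congr 1
      · simp
      · refine Finset.sum_congr rfl fun j hj => ?_
        rw [show w + 1 - 1 - (j + 1) = w - 1 - j by omega, pow_succ]
        simp
    rw [h, mul_sub, ih]
    have h' : Polynomial.C ((-1 : ℤ) ^ (w + 1)) = -Polynomial.C ((-1 : ℤ) ^ w) := by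
      rw [← Polynomial.C_neg]
      congr 1
      ring
    rw [h']
    ring

/-- An alternating coefficient (AC) polynomial: it is non-zero, and any two consecutive
coefficients between its lowest and its highest term have opposite signs. -/
def IsAlternating (f : ℤ[X]) : Prop :=
  f ≠ 0 ∧ ∀ j, f.natTrailingDegree ≤ j → j < f.natDegree → f.coeff j * f.coeff (j + 1) < 0

end ThreeBraidJones

end

/-! The Kauffman state sum is a Markov trace on the three-strand Temperley–Lieb algebra. Colouring
the circles of a state by N colours gives N ^ (number of circles) as the trace of a product of 0-1
transfer matrices, which satisfy the Temperley–Lieb relations with loop value N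
(`pow_loopCount_eq_trace`). Reduction to the words 1, e, f, ef, fe uses the relations alone, so
agreement at all N is an identity of polynomials, which can be specialised to -A² - A⁻² in any other
Temperley–Lieb algebra (`pow_loopCount_sub_one`).

The algebra chosen is the sum of the irreducible representations of dimensions 1 and 2. There a
positive letter acts as t^(1/4) times the pair (1, Burau matrix) when A = t^(-1/4) is expressed
through the variable t^(-1), and as t^(-1/4) times that pair in the variable t. Hence V = (-1)^w
t^(w/2) (t + t⁻¹ + tr B), with B the Burau product (`jones_eq_trace_burauProd`). Writing tr B = t S
gives V** = (-1)^w S.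

The symmetry is the unitarity of the Burau representation: B(t⁻¹) is, up to transposition, conjugate
to the inverse of B(t), and det B = (-t)^w. Each block σ₁^a σ₂^b contributes a factor t to B, so
t^(r-1) divides V**, and the symmetry reflects this into the degree bound
(`natDegree_le_of_coeff_symm`). For r = 1 the trace is explicit; `oneBlockPoly_add_two` rewrites it
as a sum without cancellation, from which signs and degrees are read off. -/

noncomputable section

namespace ThreeBraidJones

/-! ### Temperley–Lieb relations and normal form -/

section TemperleyLieb

/-- The relations of the Temperley–Lieb algebra on three strands, with loop value `d`. -/
structure IsTemperleyLieb {R B : Type} [CommRing R] [Ring B] [Algebra R B] (d : R)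
    (e f : B) : Prop where
  left_sq : e * e = d • e
  right_sq : f * f = d • f
  left_right_left : e * (f * e) = e
  right_left_right : f * (e * f) = f

/-- The coefficients depend only on the word and are fixed before the algebra. This uniformity
carries an identity found with transfer matrices over to another representation. -/
theorem exists_temperleyLieb_normalForm (u : List (Option (Fin 2))) :
    ∃ c₀ c₁ c₂ c₃ c₄ : ℤ[X], ∀ (R B : Type) [CommRing R] [Ring B] [Algebra R B] (d : R) (e f : B),
      IsTemperleyLieb d e f →
      (u.map fun o => o.elim 1 ![e, f]).prod = aeval d c₀ • 1 + aeval d c₁ • e + aeval d c₂ • f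
        + aeval d c₃ • (e * f) + aeval d c₄ • (f * e) := by
  induction u with
  | nil => exact ⟨1, 0, 0, 0, 0, by intros; simp⟩
  | cons o u ih =>
    obtain ⟨c₀, c₁, c₂, c₃, c₄, h⟩ := ih
    match o with
    | none => exact ⟨c₀, c₁, c₂, c₃, c₄, by intros; simp [h _ _ _ _ _ ‹_›]⟩
    | some 0 =>
      refine ⟨0, c₀ + X * c₁ + c₄, 0, c₂ + X * c₃, 0, fun R B _ _ _ d e f H => ?_⟩
      have h3 : e * (e * f) = d • (e * f) := by rw [← mul_assoc, H.left_sq, smul_mul_assoc]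
      rw [List.map_cons, List.prod_cons, h _ _ _ _ _ H]
      simp only [Option.elim, Matrix.cons_val_zero, mul_add, mul_smul_comm, H.left_sq,
        H.left_right_left, h3, map_add, map_mul, aeval_X, map_zero, mul_one]
      module
    | some 1 =>
      refine ⟨0, 0, c₀ + X * c₂ + c₃, 0, c₁ + X * c₄, fun R B _ _ _ d e f H => ?_⟩
      have h3 : f * (f * e) = d • (f * e) := by rw [← mul_assoc, H.right_sq, smul_mul_assoc]
      rw [List.map_cons, List.prod_cons, h _ _ _ _ _ H]
      simp only [Option.elim, Matrix.cons_val_one, Matrix.cons_val_fin_one, mul_add, mul_smul_comm,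
        H.right_sq, H.right_left_right, h3, map_add, map_mul, aeval_X, map_zero, mul_one]
      module

end TemperleyLieb

/-! ### Colourings and transfer matrices -/

section TransferMatrix

/-- The matrix of the cup between the positions `i` and `i + 1` on colourings by `Fin N`; the
remaining strand is in the position `2` for `i = 0` and `0` for `i = 1`. -/
def cupMatrix (N : ℕ) (i : Fin 2) : Matrix (Fin 3 → Fin N) (Fin N) ℤ :=
  Matrix.of fun x a => if x i.castSucc = x i.succ ∧ x (![2, 0] i) = a then 1 else 0

/-- The transfer matrix of the cup-cap pair between the positions `i` and `i + 1`. -/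
def cupCapMatrix (N : ℕ) (i : Fin 2) : Matrix (Fin 3 → Fin N) (Fin 3 → Fin N) ℤ :=
  cupMatrix N i * (cupMatrix N i).transpose

theorem sum_fin_three_arrow {N : ℕ} (g : (Fin 3 → Fin N) → ℤ) :
    ∑ x, g x = ∑ a, ∑ b, ∑ c, g ![a, b, c] := by
  rw [← (Fin.consEquiv fun _ : Fin 3 => Fin N).sum_comp, Fintype.sum_prod_type]
  refine Finset.sum_congr rfl fun a _ => ?_
  rw [← (Fin.consEquiv fun _ : Fin 2 => Fin N).sum_comp, Fintype.sum_prod_type]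
  refine Finset.sum_congr rfl fun b _ => ?_
  rw [← (Equiv.funUnique (Fin 1) (Fin N)).symm.sum_comp]
  refine Finset.sum_congr rfl fun c _ => congrArg g ?_
  ext i
  fin_cases i <;> rfl

theorem cupMatrix_zero_apply {N : ℕ} (p q r a : Fin N) :
    cupMatrix N 0 ![p, q, r] a = if p = q then if r = a then 1 else 0 else 0 :=
  ite_and ..

theorem cupMatrix_one_apply {N : ℕ} (p q r a : Fin N) :
    cupMatrix N 1 ![p, q, r] a = if q = r then if p = a then 1 else 0 else 0 :=
  ite_and ..

theorem transpose_cupMatrix_mul_self (N : ℕ) (i : Fin 2) :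
    (cupMatrix N i).transpose * cupMatrix N i = (N : ℤ) • 1 := by
  ext a b
  rw [Matrix.mul_apply, sum_fin_three_arrow]
  match i with
  | 0 => simp [cupMatrix_zero_apply, Matrix.one_apply, eq_comm (a := a)]
  | 1 => simp [cupMatrix_one_apply, Matrix.one_apply, eq_comm (a := a)]

/-- A cap against the neighbouring cup straightens to one strand, which transports its colour; this
zigzag identity yields the relations e f e = e and f e f = f. -/
theorem transpose_cupMatrix_mul_cupMatrix_of_ne (N : ℕ) {i j : Fin 2} (h : i ≠ j) :
    (cupMatrix N i).transpose * cupMatrix N j = 1 := by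
  ext a b
  rw [Matrix.mul_apply, sum_fin_three_arrow]
  obtain ⟨rfl, rfl⟩ | ⟨rfl, rfl⟩ : i = 0 ∧ j = 1 ∨ i = 1 ∧ j = 0 := by omega
  · simp [cupMatrix_zero_apply, cupMatrix_one_apply, Matrix.one_apply, eq_comm (a := a)]
  · simp [cupMatrix_zero_apply, cupMatrix_one_apply, Matrix.one_apply, eq_comm (a := a)]

theorem cupCapMatrix_mul_self (N : ℕ) (i : Fin 2) :
    cupCapMatrix N i * cupCapMatrix N i = (N : ℤ) • cupCapMatrix N i := by
  unfold cupCapMatrix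
  rw [Matrix.mul_assoc, ← Matrix.mul_assoc _ (cupMatrix N i), transpose_cupMatrix_mul_self,
    Matrix.smul_mul, Matrix.one_mul, Matrix.mul_smul]

theorem cupCapMatrix_mul_mul (N : ℕ) {i j : Fin 2} (h : i ≠ j) :
    cupCapMatrix N i * (cupCapMatrix N j * cupCapMatrix N i) = cupCapMatrix N i := by
  have h₁ := transpose_cupMatrix_mul_cupMatrix_of_ne N h
  have h₂ := transpose_cupMatrix_mul_cupMatrix_of_ne N h.symm
  unfold cupCapMatrix
  calc _ = cupMatrix N i * (((cupMatrix N i).transpose * cupMatrix N j) *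
        ((cupMatrix N j).transpose * cupMatrix N i)) * (cupMatrix N i).transpose := by
        simp only [Matrix.mul_assoc]
    _ = _ := by rw [h₁, h₂, Matrix.mul_one, Matrix.mul_one]

theorem isTemperleyLieb_cupCapMatrix (N : ℕ) :
    IsTemperleyLieb (N : ℤ) (cupCapMatrix N 0) (cupCapMatrix N 1) where
  left_sq := cupCapMatrix_mul_self N 0
  right_sq := cupCapMatrix_mul_self N 1
  left_right_left := cupCapMatrix_mul_mul N (by decide)
  right_left_right := cupCapMatrix_mul_mul N (by decide)

theorem trace_cupCapMatrix (N : ℕ) (i : Fin 2) : (cupCapMatrix N i).trace = (N : ℤ) ^ 2 := by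
  rw [cupCapMatrix, Matrix.trace_mul_comm, transpose_cupMatrix_mul_self,
    Matrix.trace_smul, Matrix.trace_one, Fintype.card_fin, smul_eq_mul, pow_two]

theorem trace_cupCapMatrix_mul (N : ℕ) {i j : Fin 2} (h : i ≠ j) :
    (cupCapMatrix N i * cupCapMatrix N j).trace = (N : ℤ) := by
  have h₁ := transpose_cupMatrix_mul_cupMatrix_of_ne N h
  have h₂ := transpose_cupMatrix_mul_cupMatrix_of_ne N h.symm
  unfold cupCapMatrix
  rw [Matrix.mul_assoc, Matrix.trace_mul_comm]
  calc _ = (((cupMatrix N i).transpose * cupMatrix N j) *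
        ((cupMatrix N j).transpose * cupMatrix N i)).trace := by simp only [Matrix.mul_assoc]
    _ = _ := by rw [h₁, h₂]; simp

theorem cupCapMatrix_apply (N : ℕ) (i : Fin 2) (x y : Fin 3 → Fin N) :
    cupCapMatrix N i x y = if x i.castSucc = x i.succ ∧ y i.castSucc = y i.succ ∧
      x (![2, 0] i) = y (![2, 0] i) then 1 else 0 := by
  rw [cupCapMatrix, Matrix.mul_apply]
  simp only [cupMatrix, Matrix.of_apply, Matrix.transpose_apply, ite_and, mul_ite, mul_one,
    mul_zero]
  by_cases h₁ : x i.castSucc = x i.succ <;> by_cases h₂ : y i.castSucc = y i.succ <;>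
    simp [h₁, h₂, eq_comm]

/-- Expansion of a matrix product over paths. With colourings of three positions as indices, a path
is a colouring of all level points. -/
theorem list_prod_matrix_apply {ι : Type} [Fintype ι] [DecidableEq ι] {n : ℕ}
    (M : Fin n → Matrix ι ι ℤ) (x y : ι) :
    (List.ofFn M).prod x y = ∑ p : Fin (n + 1) → ι,
      if p 0 = x ∧ p (Fin.last n) = y then ∏ k : Fin n, M k (p k.castSucc) (p k.succ) else 0 := by
  induction n generalizing x with
  | zero =>
    rw [← (Equiv.funUnique (Fin 1) ι).symm.sum_comp]
    simp [Matrix.one_apply, ite_and]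
  | succ n ih =>
    rw [List.ofFn_succ, List.prod_cons, Matrix.mul_apply,
      ← (Fin.consEquiv fun _ : Fin (n + 2) => ι).sum_comp, Fintype.sum_prod_type]
    simp only [ih, Finset.mul_sum]
    rw [Finset.sum_comm, Finset.sum_comm (s := Finset.univ (α := ι))]
    refine Finset.sum_congr rfl fun p _ => ?_
    simp [Fin.consEquiv, Fin.prod_univ_succ, ite_and, ← Fin.succ_last]

theorem trace_list_prod {ι : Type} [Fintype ι] [DecidableEq ι] {n : ℕ}
    (M : Fin n → Matrix ι ι ℤ) :
    (List.ofFn M).prod.trace = ∑ p : Fin (n + 1) → ι,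
      if p 0 = p (Fin.last n) then ∏ k : Fin n, M k (p k.castSucc) (p k.succ) else 0 := by
  simp only [Matrix.trace, Matrix.diag_apply, list_prod_matrix_apply]
  rw [Finset.sum_comm]
  refine Finset.sum_congr rfl fun p _ => ?_
  simp [ite_and, eq_comm]

end TransferMatrix

/-! ### Counting circles and the state sum -/

section LoopCount

/-- The word of smoothings of a state: `none` for two vertical arcs, `some i` for a cup-cap pair. -/
def smoothing {n : ℕ} (β : BraidWord n) (s : KauffmanState β) (k : Fin β.length) :
    Option (Fin n) :=
  if s k = (β.get k).positive then none else some (β.get k).index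

theorem fin_two_forall_ne (i : Fin 2) (P : Fin 3 → Prop) :
    (∀ p, p ≠ i.castSucc → p ≠ i.succ → P p) ↔ P (![2, 0] i) := by
  fin_cases i <;> simp [Fin.forall_fin_succ]

/-- Transfer matrix entries are indicators of compatibility between consecutive levels, so
colourings constant on circles are the closed paths of weight 1. -/
theorem forall_stateArc_iff {N : ℕ} (β : BraidWord 2) (s : KauffmanState β)
    (g : LevelPoint β → Fin N) :
    (∀ x y, StateArc β s x y → g x = g y) ↔
      (∀ p, g (0, p) = g (Fin.last _, p)) ∧ ∀ k : Fin β.length,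
        (smoothing β s k).elim 1 (cupCapMatrix N) (fun p => g (k.castSucc, p))
          (fun p => g (k.succ, p)) = 1 := by
  constructor
  · intro h
    refine ⟨fun p => h _ _ (.closing p), fun k => ?_⟩
    have hs := fun p h₁ h₂ => h _ _ (.strand k p h₁ h₂)
    rw [fin_two_forall_ne _ fun p => g (k.castSucc, p) = g (k.succ, p)] at hs
    by_cases hk : s k = (β.get k).positive
    · have h₁ := h _ _ (.vertical_left k hk)
      have h₂ := h _ _ (.vertical_right k hk)
      rw [smoothing, if_pos hk, Option.elim_none, Matrix.one_apply, if_pos]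
      funext p
      by_cases hp : p = (β.get k).index.castSucc
      · rw [hp, h₁]
      by_cases hp' : p = (β.get k).index.succ
      · rw [hp', h₂]
      exact h _ _ (.strand k p hp hp')
    · have h₁ := h _ _ (.horizontal_bottom k hk)
      have h₂ := h _ _ (.horizontal_top k hk)
      rw [smoothing, if_neg hk, Option.elim_some, cupCapMatrix_apply, if_pos ⟨h₁, h₂, hs⟩]
  · rintro ⟨hc, h⟩
    have hv : ∀ k, s k = (β.get k).positive → ∀ p, g (k.castSucc, p) = g (k.succ, p) := by
      intro k hk p
      have := h k
      rw [smoothing, if_pos hk, Option.elim_none, Matrix.one_apply] at this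
      exact congrFun (by_contra fun hne => by rw [if_neg hne] at this; simp at this) p
    have hh : ∀ k, s k ≠ (β.get k).positive → _ := fun k hk => by
      have := h k
      rw [smoothing, if_neg hk, Option.elim_some, cupCapMatrix_apply] at this
      exact by_contra fun hne => by rw [if_neg hne] at this; exact absurd this (by simp)
    intro x y hxy
    cases hxy with
    | strand k p h₁ h₂ =>
      by_cases hk : s k = (β.get k).positive
      · exact hv k hk p
      · exact (fin_two_forall_ne _ fun p => g (k.castSucc, p) = g (k.succ, p)).2
          (hh k hk).2.2 p h₁ h₂
    | vertical_left k hk => exact hv k hk _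
    | vertical_right k hk => exact hv k hk _
    | horizontal_bottom k hk => exact (hh k hk).1
    | horizontal_top k hk => exact (hh k hk).2.1
    | closing p => exact hc p

theorem elim_cupCapMatrix_eq_zero_or_one (N : ℕ) (o : Option (Fin 2)) (x y : Fin 3 → Fin N) :
    o.elim 1 (cupCapMatrix N) x y = 0 ∨ o.elim 1 (cupCapMatrix N) x y = 1 := by
  cases o with
  | none => rw [Option.elim_none, Matrix.one_apply]; split_ifs <;> simp
  | some i => rw [Option.elim_some, cupCapMatrix_apply]; split_ifs <;> simp

/-- The number of colourings of the circles of a state is a trace of transfer matrices. -/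
theorem pow_loopCount_eq_trace (N : ℕ) (β : BraidWord 2) (s : KauffmanState β) :
    (N : ℤ) ^ loopCount β s =
      (List.ofFn fun k => (smoothing β s k).elim 1 (cupCapMatrix N)).prod.trace := by
  classical
  have e : (Quot (StateArc β s) → Fin N) ≃
      {g : LevelPoint β → Fin N // ∀ x y, StateArc β s x y → g x = g y} :=
    { toFun := fun g => ⟨fun x => g (Quot.mk _ x), fun x y h => congrArg g (Quot.sound h)⟩
      invFun := fun g => Quot.lift g.1 g.2
      left_inv := fun g => by funext x; induction x using Quot.ind; rfl
      right_inv := fun g => rfl }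
  have h₁ : N ^ loopCount β s =
      Nat.card {g : LevelPoint β → Fin N // ∀ x y, StateArc β s x y → g x = g y} := by
    rw [← Nat.card_congr e, Nat.card_fun, loopCount, Nat.card_fin]
  rw [← Nat.cast_pow, h₁, trace_list_prod, Nat.card_eq_fintype_card, Fintype.card_subtype,
    Finset.card_filter, Nat.cast_sum, ← (Equiv.curry _ _ _).symm.sum_comp]
  refine Finset.sum_congr rfl fun p _ => ?_
  simp only [forall_stateArc_iff]
  simp only [Equiv.curry_symm_apply, Function.uncurry_apply_pair, ite_and,
    ← funext_iff (f := p 0)]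
  split_ifs with hc hk
  · exact (Finset.prod_eq_one fun k _ => hk k).symm
  · push Not at hk
    obtain ⟨k, hk⟩ := hk
    rw [Finset.prod_eq_zero (Finset.mem_univ k)]
    · simp
    · exact (elim_cupCapMatrix_eq_zero_or_one N _ _ _).resolve_right hk
  · simp

theorem loopCount_pos {n : ℕ} (β : BraidWord n) (s : KauffmanState β) : 0 < loopCount β s := by
  have : Nonempty (Quot (StateArc β s)) := ⟨Quot.mk _ (0, 0)⟩
  exact Nat.card_pos

/-- The power of the loop value is the value on the smoothed word of any Markov trace. -/
theorem pow_loopCount_sub_one {R B : Type} [CommRing R] [Ring B] [Algebra R B] {d : R} {e f : B}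
    (H : IsTemperleyLieb d e f) (τ : B →ₗ[R] R) (h₁ : τ 1 = d ^ 2) (he : τ e = d) (hf : τ f = d)
    (hef : τ (e * f) = 1) (hfe : τ (f * e) = 1) (β : BraidWord 2) (s : KauffmanState β) :
    d ^ (loopCount β s - 1) =
      τ (List.ofFn fun k => (smoothing β s k).elim 1 ![e, f]).prod := by
  obtain ⟨c₀, c₁, c₂, c₃, c₄, h⟩ := exists_temperleyLieb_normalForm (List.ofFn (smoothing β s))
  simp only [List.map_ofFn] at h
  -- The transfer matrix traces of 1, a generator and a mixed product are N³, N² and N. After one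
  -- factor N is taken out, these are the prescribed values of `τ`.
  have key : (X : ℤ[X]) ^ loopCount β s =
      X * (c₀ * X ^ 2 + c₁ * X + c₂ * X + c₃ + c₄) := by
    refine Polynomial.eq_of_infinite_eval_eq _ _ (Set.infinite_of_injective_forall_mem
      (Nat.cast_injective (R := ℤ)) fun N => ?_)
    have hE : cupCapMatrix N = ![cupCapMatrix N 0, cupCapMatrix N 1] := by
      funext i; fin_cases i <;> rfl
    have := pow_loopCount_eq_trace N β s
    rw [hE] at this
    have h' := h ℤ _ N _ _ (isTemperleyLieb_cupCapMatrix N)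
    simp only [Function.comp_def] at h'
    rw [h'] at this
    simp only [Matrix.trace_add, Matrix.trace_smul, trace_cupCapMatrix,
      trace_cupCapMatrix_mul N (show (0 : Fin 2) ≠ 1 by decide),
      trace_cupCapMatrix_mul N (show (1 : Fin 2) ≠ 0 by decide), Matrix.trace_one,
      Fintype.card_fun, Fintype.card_fin, coe_aeval_eq_eval, smul_eq_mul] at this
    simp only [Set.mem_ofPred_eq, eval_pow, eval_X, eval_mul, eval_add, this]
    push_cast
    ring
  -- At least one circle exists, so the truncated exponent `loopCount β s - 1` is genuine and X can
  -- be cancelled.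
  obtain ⟨m, hm⟩ := Nat.exists_eq_succ_of_ne_zero (loopCount_pos β s).ne'
  rw [hm, pow_succ', mul_right_inj' X_ne_zero] at key
  rw [hm, Nat.succ_sub_one]
  have h' := h R B d e f H
  simp only [Function.comp_def] at h'
  rw [h']
  have := congrArg (aeval d) key
  simp only [map_pow, map_add, map_mul, aeval_X] at this
  simp only [map_add, map_smul, h₁, he, hf, hef, hfe, smul_eq_mul, this, mul_one]

theorem sum_list_prod_ofFn {B : Type} [Ring B] {n : ℕ} (g : Fin n → Bool → B) :
    ∑ s : Fin n → Bool, (List.ofFn fun k => g k (s k)).prod =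
      (List.ofFn fun k => ∑ b, g k b).prod := by
  induction n with
  | zero => simp
  | succ n ih =>
    rw [← (Fin.consEquiv fun _ : Fin (n + 1) => Bool).sum_comp, Fintype.sum_prod_type]
    simp only [Fin.consEquiv, Equiv.coe_fn_mk, List.ofFn_succ, List.prod_cons, Fin.cons_zero,
      Fin.cons_succ, ← Finset.mul_sum, ih fun k => g k.succ, ← Finset.sum_mul]

theorem list_prod_ofFn_smul {R B : Type} [CommRing R] [Ring B] [Algebra R B] {n : ℕ}
    (c : Fin n → R) (g : Fin n → B) :
    (List.ofFn fun k => c k • g k).prod = (∏ k, c k) • (List.ofFn g).prod := by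
  induction n with
  | zero => simp
  | succ n ih =>
    simp only [List.ofFn_succ, List.prod_cons, ih, Fin.prod_univ_succ, smul_mul_smul_comm]

/-- The image of a letter under the Kauffman resolution of the crossing. -/
def resolve {R B : Type} [CommRing R] [Ring B] [Algebra R B] (x y : R) (e f : B) (l : Letter 2) :
    B :=
  if l.positive then x • 1 + y • ![e, f] l.index else y • 1 + x • ![e, f] l.index

/-- The state sum is a Markov trace of the product of the resolved letters. -/
theorem stateSum_eq_markovTrace {R B : Type} [CommRing R] [Ring B] [Algebra R B] {d : R} {e f : B}
    (H : IsTemperleyLieb d e f) (τ : B →ₗ[R] R) (h₁ : τ 1 = d ^ 2) (he : τ e = d) (hf : τ f = d)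
    (hef : τ (e * f) = 1) (hfe : τ (f * e) = 1) (x y : R) (β : BraidWord 2) :
    ∑ s : KauffmanState β, (∏ k, if s k then x else y) * d ^ (loopCount β s - 1) =
      τ (β.map (resolve x y e f)).prod := by
  have hβ : β.map (resolve x y e f) = List.ofFn fun k => ∑ b : Bool,
      (if b then x else y) • ((if b = (β.get k).positive then none
        else some (β.get k).index : Option (Fin 2)).elim 1 ![e, f]) := by
    conv_lhs => rw [← List.ofFn_get β, List.map_ofFn]
    congr 1
    funext k
    cases hk : (β.get k).positive <;> simp_all [resolve, add_comm]
  rw [hβ, ← sum_list_prod_ofFn, map_sum]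
  refine Finset.sum_congr rfl fun s _ => ?_
  rw [pow_loopCount_sub_one H τ h₁ he hf hef hfe, list_prod_ofFn_smul, map_smul, smul_eq_mul]
  rfl

end LoopCount

/-! ### The Burau trace formula for the Jones polynomial -/

section Burau

/-- The reduced Burau matrix of the generator `σ_{i+1}`. -/
def burau (i : Fin 2) : Matrix (Fin 2) (Fin 2) ℤ[X] :=
  ![!![-X, 1; 0, 1], !![1, 0; X, -X]] i

/-- The product of the Burau matrices of the letters of a positive braid word. -/
def burauProd (β : BraidWord 2) : Matrix (Fin 2) (Fin 2) ℤ[X] :=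
  (β.map fun l => burau l.index).prod

/-- The loop value `-A² - A⁻²`. -/
def loopValue : ℤ[T;T⁻¹] := -T 2 - T (-2)

/-- The Temperley–Lieb generators on the two irreducible representations of dimensions 1 and 2. -/
def tlGen (i : Fin 2) : ℤ[T;T⁻¹] × Matrix (Fin 2) (Fin 2) ℤ[T;T⁻¹] :=
  (0, ![!![loopValue, T (-2); 0, 0], !![0, 0; T 2, loopValue]] i)

/-- The Markov trace, as a combination of the traces of the two representations. -/
def markovTrace : ℤ[T;T⁻¹] × Matrix (Fin 2) (Fin 2) ℤ[T;T⁻¹] →ₗ[ℤ[T;T⁻¹]] ℤ[T;T⁻¹] :=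
  (loopValue ^ 2 - 2) • LinearMap.fst _ _ _ +
    Matrix.traceLinearMap (Fin 2) ℤ[T;T⁻¹] ℤ[T;T⁻¹] ∘ₗ LinearMap.snd _ _ _

theorem T_two_mul_T_neg_two : (T 2 * T (-2) : ℤ[T;T⁻¹]) = 1 := by
  rw [← T_add, add_neg_cancel, T_zero]

theorem isTemperleyLieb_tlGen : IsTemperleyLieb loopValue (tlGen 0) (tlGen 1) := by
  have h := T_two_mul_T_neg_two
  have h' : (T (-2) * T 2 : ℤ[T;T⁻¹]) = 1 := by rw [mul_comm, h]
  constructor <;> simp only [tlGen, Matrix.cons_val_zero, Matrix.cons_val_one,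
    Matrix.cons_val_fin_one, Prod.mk_mul_mk, Prod.smul_mk, mul_zero, smul_zero,
    Matrix.mul_fin_two, Matrix.smul_of, Prod.mk.injEq, true_and]
  all_goals
    refine Matrix.ext fun i j => ?_
    fin_cases i <;> fin_cases j <;> simp [h, h', mul_comm, -T_mul, -mul_T_assoc]
  all_goals linear_combination loopValue * h

theorem markovTrace_mk (z : ℤ[T;T⁻¹]) (M : Matrix (Fin 2) (Fin 2) ℤ[T;T⁻¹]) :
    markovTrace (z, M) = (loopValue ^ 2 - 2) * z + M.trace := rfl

theorem loopValue_sq : loopValue ^ 2 - 2 = T 4 + T (-4) := by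
  have h := T_two_mul_T_neg_two
  have h₁ : (T 4 : ℤ[T;T⁻¹]) = T 2 * T 2 := by rw [← T_add]; norm_num
  have h₂ : (T (-4) : ℤ[T;T⁻¹]) = T (-2) * T (-2) := by rw [← T_add]; norm_num
  rw [loopValue, h₁, h₂]
  linear_combination 2 * h

/-- With t = T 4, the diagonal entry comes from 1 + T 2 * `loopValue` = -t; the one-dimensional
component is 1 because both generators act there by 0. -/
theorem resolve_tlGen (i : Fin 2) :
    resolve (T (-1) : ℤ[T;T⁻¹]) (T 1) (tlGen 0) (tlGen 1) ⟨i, true⟩ =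
      (T (-1) : ℤ[T;T⁻¹]) • (1, (burau i).map (aeval (T 4 : ℤ[T;T⁻¹]))) := by
  have h₀ : (T 1 * T (-2) : ℤ[T;T⁻¹]) = T (-1) := by rw [← T_add]; norm_num
  have h₁ : (T (-1) * T 4 : ℤ[T;T⁻¹]) = T 3 := by rw [← T_add]; norm_num
  have h₂ : (T 1 * T 2 : ℤ[T;T⁻¹]) = T 3 := by rw [← T_add]; norm_num
  obtain rfl | rfl : i = 0 ∨ i = 1 := by omega
  all_goals
    simp only [resolve, tlGen, burau, if_true, Matrix.cons_val_zero, Matrix.cons_val_one,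
      Matrix.cons_val_fin_one, Prod.smul_mk, smul_zero, Prod.mk_one_one.symm, Prod.mk_add_mk,
      add_zero, Prod.mk.injEq, true_and]
    refine Matrix.ext fun i j => ?_
    fin_cases i <;> fin_cases j <;>
      simp [loopValue, mul_sub, h₀, h₁, h₂, -T_mul, -mul_T_assoc]

theorem list_map_resolve_prod (β : BraidWord 2) (hβ : ∀ l ∈ β, l.positive = true) :
    (β.map (resolve (T (-1) : ℤ[T;T⁻¹]) (T 1) (tlGen 0) (tlGen 1))).prod =
      (T (-(β.length : ℤ)) : ℤ[T;T⁻¹]) • (1, (burauProd β).map (aeval (T 4 : ℤ[T;T⁻¹]))) := by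
  induction β with
  | nil =>
    simp [burauProd]
    rfl
  | cons l β ih =>
    obtain ⟨i, p⟩ := l
    obtain rfl : p = true := hβ _ List.mem_cons_self
    rw [List.map_cons, List.prod_cons, ih fun l hl => hβ l (List.mem_cons_of_mem _ hl),
      resolve_tlGen, smul_mul_smul_comm, Prod.mk_mul_mk, mul_one, ← T_add, burauProd, burauProd,
      List.map_cons, List.prod_cons, Matrix.map_mul, List.length_cons]
    congr 2
    push_cast
    ring

theorem T_finset_sum {ι : Type} (s : Finset ι) (g : ι → ℤ) :
    (T (∑ i ∈ s, g i) : ℤ[T;T⁻¹]) = ∏ i ∈ s, T (g i) := by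
  classical
  induction s using Finset.induction_on with
  | empty => simp
  | insert i s hi ih => rw [Finset.sum_insert hi, Finset.prod_insert hi, T_add, ih]

theorem invert_kauffmanBracket (β : BraidWord 2) (hβ : ∀ l ∈ β, l.positive = true) :
    invert (kauffmanBracket β) = T (-(β.length : ℤ)) *
      (T 4 + T (-4) + aeval (T 4 : ℤ[T;T⁻¹]) (burauProd β).trace) := by
  -- Inversion puts A = t^(-1/4), exchanging T 1 and T (-1) in the weights, and fixes the loop
  -- value.
  have h : invert (kauffmanBracket β) = ∑ s : KauffmanState β,
      (∏ k, if s k then (T (-1) : ℤ[T;T⁻¹]) else T 1) * loopValue ^ (loopCount β s - 1) := by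
    rw [kauffmanBracket, map_sum]
    refine Finset.sum_congr rfl fun s _ => ?_
    rw [map_mul, T_finset_sum, map_prod, map_pow, map_sub, map_neg, invert_T, invert_T, loopValue,
      neg_neg, ← neg_add', ← neg_add', add_comm (T (-2))]
    congr 1
    refine Finset.prod_congr rfl fun k _ => ?_
    split_ifs <;> simp
  have htr : ∀ M : Matrix (Fin 2) (Fin 2) ℤ[X],
      (M.map (aeval (T 4 : ℤ[T;T⁻¹]))).trace = aeval (T 4 : ℤ[T;T⁻¹]) M.trace := fun M => by
    simp [Matrix.trace_fin_two]
  rw [h, stateSum_eq_markovTrace isTemperleyLieb_tlGen markovTrace, list_map_resolve_prod β hβ,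
    map_smul, markovTrace_mk, htr, loopValue_sq, mul_one, smul_eq_mul]
  · rw [← Prod.mk_one_one, markovTrace_mk, Matrix.trace_one]
    simp
  · simp [tlGen, markovTrace_mk, Matrix.trace_fin_two]
  · simp [tlGen, markovTrace_mk, Matrix.trace_fin_two]
  · simpa [tlGen, markovTrace_mk, Matrix.trace_fin_two, -T_mul, -mul_T_assoc, mul_comm] using
      T_two_mul_T_neg_two
  · simpa [tlGen, markovTrace_mk, Matrix.trace_fin_two, -T_mul, -mul_T_assoc] using
      T_two_mul_T_neg_two

theorem writhe_of_positive {n : ℕ} (β : BraidWord n) (hβ : ∀ l ∈ β, l.positive = true) :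
    writhe β = β.length := by
  rw [writhe, List.map_congr_left (g := fun _ => (1 : ℤ)) fun l hl => by simp [hβ l hl]]
  simp

/-- The Jones polynomial of a positive closed 3-braid by the trace of the Burau matrix. -/
theorem jones_eq_trace_burauProd (β : BraidWord 2) (hβ : ∀ l ∈ β, l.positive = true) :
    jones β = LaurentPolynomial.C ((-1 : ℤ) ^ β.length) * T (2 * (β.length : ℤ)) *
      (T 4 + T (-4) + aeval (T 4 : ℤ[T;T⁻¹]) (burauProd β).trace) := by
  rw [jones, map_mul, map_mul, invert_kauffmanBracket β hβ, writhe_of_positive β hβ, invert_C,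
    invert_T, ← mul_assoc, mul_assoc (LaurentPolynomial.C _), ← T_add,
    show -(-3 * (β.length : ℤ)) + -(β.length : ℤ) = 2 * β.length by ring]
  simp

end Burau

/-! ### Unitarity and the symmetry of coefficients -/

section Symmetry

/-- The matrix of a sesquilinear form preserved by the Burau matrices. -/
def burauForm : Matrix (Fin 2) (Fin 2) ℤ[T;T⁻¹] := !![1 + T 1, -1; -T 1, 1 + T 1]

/-- The substitution of `t⁻¹` for `t`. -/
def invSubst : ℤ[X] →+* ℤ[T;T⁻¹] := (invert : ℤ[T;T⁻¹] ≃ₐ[ℤ] _).toRingHom.comp toLaurent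

theorem T_one_mul_T_neg_one : (T 1 * T (-1) : ℤ[T;T⁻¹]) = 1 := by
  rw [← T_add, add_neg_cancel, T_zero]

theorem invSubst_X : invSubst X = T (-1) := by simp [invSubst]

theorem burauForm_invariant (i : Fin 2) :
    ((burau i).map invSubst).transpose * burauForm * (burau i).map toLaurent = burauForm := by
  have h := T_one_mul_T_neg_one
  obtain rfl | rfl : i = 0 ∨ i = 1 := by omega
  all_goals
    refine Matrix.ext fun i j => ?_
    fin_cases i <;> fin_cases j <;>
      simp [burau, burauForm, Matrix.mul_apply, Fin.sum_univ_two, invSubst_X, -T_mul, -mul_T_assoc]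
  all_goals grind

theorem burauForm_invariant_prod (β : BraidWord 2) :
    ((burauProd β).map invSubst).transpose * burauForm * (burauProd β).map toLaurent =
      burauForm := by
  induction β with
  | nil => simp [burauProd]
  | cons l β ih =>
    have h : burauProd (l :: β) = burau l.index * burauProd β := by simp [burauProd]
    rw [h, Matrix.map_mul, Matrix.map_mul, Matrix.transpose_mul]
    calc _ = ((burauProd β).map invSubst).transpose * (((burau l.index).map invSubst).transpose *
          burauForm * (burau l.index).map toLaurent) * (burauProd β).map toLaurent := by
          simp only [Matrix.mul_assoc]
      _ = _ := by rw [burauForm_invariant, ih]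

/-- Invariance makes the transpose of U conjugate to the inverse of M, whose trace in size 2 is tr M
/ det M. Adjugates replace inverses, so that only det J must be cancelled. -/
theorem det_mul_trace_of_invariant {R : Type} [CommRing R] [IsDomain R]
    {U J M : Matrix (Fin 2) (Fin 2) R} (hJ : J.det ≠ 0) (h : U.transpose * J * M = J) :
    M.det * U.trace = M.trace := by
  have key : (J.det * M.det) • U.transpose = J * M.adjugate * J.adjugate := by
    calc _ = U.transpose * (J * (M * M.adjugate) * J.adjugate) := by
          rw [Matrix.mul_adjugate]
          simp [Matrix.mul_adjugate, smul_smul, mul_comm]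
      _ = U.transpose * J * M * M.adjugate * J.adjugate := by simp only [Matrix.mul_assoc]
      _ = _ := by rw [h]
  have h₂ := congrArg Matrix.trace key
  rw [Matrix.trace_mul_comm, ← Matrix.mul_assoc, Matrix.adjugate_mul, Matrix.trace_smul,
    Matrix.trace_transpose, Matrix.smul_mul, Matrix.one_mul, Matrix.trace_smul, smul_eq_mul,
    smul_eq_mul, mul_assoc] at h₂
  rw [mul_left_cancel₀ hJ h₂]
  simp [Matrix.adjugate_fin_two, Matrix.trace_fin_two, add_comm]

theorem det_burauForm_ne_zero : burauForm.det ≠ 0 := by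
  have h : burauForm.det = toLaurent (1 + X + X ^ 2 : ℤ[X]) := by
    simp only [burauForm, Matrix.det_fin_two_of, map_add, map_pow, toLaurent_X, map_one]
    ring
  rw [h, toLaurent_ne_zero]
  intro h
  simpa using congrArg (eval 0) h

theorem det_burauProd (β : BraidWord 2) : (burauProd β).det = (-X) ^ β.length := by
  induction β with
  | nil => simp [burauProd]
  | cons l β ih =>
    have h : burauProd (l :: β) = burau l.index * burauProd β := by simp [burauProd]
    have h' : ∀ i, (burau i).det = -X := fun i => by
      obtain rfl | rfl : i = 0 ∨ i = 1 := by omega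
      all_goals simp [burau]
    rw [h, Matrix.det_mul, ih, h', List.length_cons, pow_succ']

theorem trace_burauProd_symm (β : BraidWord 2) :
    (-T 1) ^ β.length * invSubst (burauProd β).trace = toLaurent (burauProd β).trace := by
  have h := det_mul_trace_of_invariant det_burauForm_ne_zero (burauForm_invariant_prod β)
  have h₁ : ((burauProd β).map toLaurent).det = toLaurent (burauProd β).det :=
    (RingHom.map_det ..).symm
  have htr : ∀ g : ℤ[X] →+* ℤ[T;T⁻¹], ((burauProd β).map g).trace = g (burauProd β).trace :=
    fun g => by simp [Matrix.trace_fin_two]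
  rwa [h₁, htr, htr, det_burauProd, map_pow, map_neg, toLaurent_X] at h

theorem symm_of_trace_burauProd_eq {β : BraidWord 2} {S : ℤ[X]}
    (hS : (burauProd β).trace = X * S) :
    LaurentPolynomial.C ((-1 : ℤ) ^ β.length) * T (β.length : ℤ) * invert (toLaurent S) =
      T 2 * toLaurent S := by
  have h := trace_burauProd_symm β
  rw [hS, map_mul, map_mul, toLaurent_X, invSubst_X, neg_pow, T_pow, mul_one] at h
  have h₁ := T_one_mul_T_neg_one
  have h₂ : (T 2 : ℤ[T;T⁻¹]) = T 1 * T 1 := by rw [← T_add]; norm_num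
  have h₃ : invSubst S = invert (toLaurent S) := rfl
  rw [h₂, map_pow, map_neg, map_one, ← h₃]
  linear_combination T 1 * h - (-1) ^ β.length * T (β.length : ℤ) * invSubst S * h₁

theorem coeff_T_mul (f : ℤ[T;T⁻¹]) (m n : ℤ) : (T m * f).coeff n = f.coeff (n - m) := by
  rw [T, AddMonoidAlgebra.coeff_single_mul_apply, one_mul, neg_add_eq_sub]

theorem coeff_symm_of_laurent_symm {S : ℤ[T;T⁻¹]} {w : ℕ}
    (h : LaurentPolynomial.C ((-1 : ℤ) ^ w) * T (w : ℤ) * invert S = T 2 * S) (j : ℤ) :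
    S.coeff j = (-1) ^ w * S.coeff ((w : ℤ) - j - 2) := by
  have := congrArg (fun f => f.coeff (j + 2)) h
  beta_reduce at this
  rw [mul_assoc, ← LaurentPolynomial.smul_eq_C_mul, AddMonoidAlgebra.coeff_smul,
    Finsupp.smul_apply, coeff_T_mul, coeff_T_mul, invert_apply, smul_eq_mul] at this
  rw [show j + 2 - 2 = j by ring, show -(j + 2 - (w : ℤ)) = w - j - 2 by ring] at this
  exact this.symm

theorem coeff_toLaurent_natCast (f : ℤ[X]) (n : ℕ) : (toLaurent f).coeff (n : ℤ) = f.coeff n := by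
  rw [coeff_toLaurent]
  exact Finsupp.mapDomain_apply Nat.cast_injective _ _

theorem coeff_toLaurent_of_neg (f : ℤ[X]) {n : ℤ} (hn : n < 0) : (toLaurent f).coeff n = 0 := by
  rw [coeff_toLaurent]
  refine Finsupp.mapDomain_of_notMem_range _ _ ?_
  rintro ⟨m, rfl⟩
  exact absurd hn (by simp)

/-- The reflection j ↦ w - 2 - j carries the top coefficients to the lowest ones, which vanish by
divisibility, or to negative indices. -/
theorem natDegree_le_of_coeff_symm {f : ℤ[X]} {w m : ℕ} (hm : X ^ m ∣ f)
    (h : ∀ j : ℤ, (toLaurent f).coeff j = (-1) ^ w * (toLaurent f).coeff ((w : ℤ) - j - 2)) :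
    f.natDegree ≤ w - 2 - m := by
  refine natDegree_le_iff_coeff_eq_zero.2 fun n hn => ?_
  rw [← coeff_toLaurent_natCast, h]
  by_cases h₀ : (w : ℤ) - n - 2 < 0
  · rw [coeff_toLaurent_of_neg f h₀, mul_zero]
  · obtain ⟨k, hk⟩ := Int.eq_ofNat_of_zero_le (not_lt.1 h₀)
    rw [hk, coeff_toLaurent_natCast, X_pow_dvd_iff.1 hm k (by omega), mul_zero]

end Symmetry

/-! ### Burau matrices of the blocks -/

section PositiveWord

theorem altPoly_succ (n : ℕ) : altPoly (n + 1) = X ^ n - altPoly n := by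
  unfold altPoly
  rw [Finset.sum_range_succ', sub_eq_add_neg, add_comm, ← Finset.sum_neg_distrib]
  congr 1
  · simp
  · refine Finset.sum_congr rfl fun j hj => ?_
    rw [show n + 1 - 1 - (j + 1) = n - 1 - j by omega, pow_succ]
    simp

theorem altPoly_succ' (n : ℕ) : altPoly (n + 1) = X * altPoly n + Polynomial.C ((-1 : ℤ) ^ n) := by
  linear_combination altPoly_succ n - altPoly_mul n

/-- `1 - X + X² - ⋯`, with `n` terms. -/
def negGeom (n : ℕ) : ℤ[X] := (-1) ^ (n + 1) * altPoly n

theorem negGeom_succ (n : ℕ) : negGeom (n + 1) = negGeom n + (-X) ^ n := by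
  rw [negGeom, negGeom, altPoly_succ, neg_pow (X : ℤ[X])]
  ring

theorem burau_zero_pow (n : ℕ) : burau 0 ^ n = !![(-X) ^ n, negGeom n; 0, 1] := by
  induction n with
  | zero => simp [negGeom, altPoly, Matrix.one_fin_two]
  | succ n ih =>
    rw [pow_succ, ih, burau, Matrix.cons_val_zero, Matrix.mul_fin_two, negGeom_succ]
    simp [pow_succ, add_comm]

theorem burau_one_pow (n : ℕ) : burau 1 ^ n = !![1, 0; X * negGeom n, (-X) ^ n] := by
  induction n with
  | zero => simp [negGeom, altPoly, Matrix.one_fin_two]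
  | succ n ih =>
    rw [pow_succ, ih, burau, Matrix.cons_val_one, Matrix.cons_val_fin_one, Matrix.mul_fin_two,
      negGeom_succ]
    simp [pow_succ, mul_add, mul_comm]

/-- The product of the Burau matrices of `σ₁ ^ a σ₂ ^ b`, divided by `X`. -/
def burauBlock (a b : ℕ) : Matrix (Fin 2) (Fin 2) ℤ[X] :=
  !![negGeom a * negGeom b - (-X) ^ (a - 1), -negGeom a * (-X) ^ (b - 1);
    negGeom b, -(-X) ^ (b - 1)]

/-- Positive exponents make all four entries divisible by X. This factor per block lowers the degree
of V** when there are several blocks. -/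
theorem burau_pow_mul_pow {a b : ℕ} (ha : 0 < a) (hb : 0 < b) :
    burau 0 ^ a * burau 1 ^ b = (X : ℤ[X]) • burauBlock a b := by
  obtain ⟨a, rfl⟩ := Nat.exists_eq_succ_of_ne_zero ha.ne'
  obtain ⟨b, rfl⟩ := Nat.exists_eq_succ_of_ne_zero hb.ne'
  rw [burau_zero_pow, burau_one_pow, burauBlock, Matrix.mul_fin_two, Matrix.smul_of]
  simp only [Nat.succ_eq_add_one, Nat.add_sub_cancel, Matrix.smul_cons, smul_eq_mul,
    Matrix.smul_empty]
  congr 3 <;> ring_nf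

theorem positive_of_mem_positiveWord {r : ℕ} (a b : Fin r → ℕ) :
    ∀ l ∈ positiveWord a b, l.positive = true := by
  intro l hl
  simp only [positiveWord, List.mem_flatten, List.mem_ofFn, exists_exists_eq_and,
    List.mem_append, List.mem_replicate] at hl
  obtain ⟨j, ⟨-, rfl⟩ | ⟨-, rfl⟩⟩ := hl <;> rfl

theorem length_positiveWord {r : ℕ} (a b : Fin r → ℕ) :
    (positiveWord a b).length = ∑ j, (a j + b j) := by
  rw [positiveWord, List.length_flatten, List.map_ofFn, List.sum_ofFn]
  simp

theorem burauProd_positiveWord {r : ℕ} (a b : Fin r → ℕ) (ha : ∀ j, 0 < a j) (hb : ∀ j, 0 < b j) :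
    burauProd (positiveWord a b) =
      (X : ℤ[X]) ^ r • (List.ofFn fun j => burauBlock (a j) (b j)).prod := by
  have h : burauProd (positiveWord a b) =
      (List.ofFn fun j => burau 0 ^ a j * burau 1 ^ b j).prod := by
    rw [burauProd, positiveWord, List.map_flatten, List.prod_flatten, List.map_ofFn, List.map_ofFn]
    simp [Function.comp_def]
  rw [h, funext fun j => burau_pow_mul_pow (ha j) (hb j), list_prod_ofFn_smul]
  simp

end PositiveWord

/-! ### Coefficients for a single block -/

section OneBlock

/-- A sign determined by the parity of the index makes neighbours opposite; strictness on the whole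
interval from `lo` to `hi` excludes gaps. -/
theorem isAlternating_of_forall_sign {f : ℤ[X]} {w lo hi : ℕ} (h : lo ≤ hi)
    (hpos : ∀ j, lo ≤ j → j ≤ hi → 0 < (-1) ^ (j + w) * f.coeff j)
    (hlo : ∀ j, j < lo → f.coeff j = 0) (hhi : f.natDegree ≤ hi) : IsAlternating f := by
  have hf : f ≠ 0 := by
    rintro rfl
    simpa using hpos lo le_rfl h
  have htr : lo ≤ f.natTrailingDegree := le_natTrailingDegree hf fun j hj => hlo j hj
  refine ⟨hf, fun j h₁ h₂ => ?_⟩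
  have h₃ := mul_pos (hpos j (htr.trans h₁) (by omega)) (hpos (j + 1) (by omega) (by omega))
  have h₄ : ((-1 : ℤ) ^ (j + w)) * (-1) ^ (j + w) = 1 := by rw [← mul_pow]; simp
  rw [show j + 1 + w = j + w + 1 by ring, pow_succ] at h₃
  linear_combination h₃ - f.coeff j * f.coeff (j + 1) * h₄

theorem sign_eq_of_nonneg {c : ℤ} {n : ℕ} (h : 0 ≤ (-1) ^ n * c) (hc : c ≠ 0) :
    c.sign = (-1) ^ n := by
  rcases neg_one_pow_eq_or ℤ n with h' | h' <;> rw [h'] at h ⊢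
  · exact Int.sign_eq_one_of_pos (by omega)
  · exact Int.sign_eq_neg_one_of_neg (by omega)

/-- The polynomial `V**` of `σ₁ ^ a σ₂ ^ b`. -/
def oneBlockPoly (a b : ℕ) : ℤ[X] :=
  altPoly a * altPoly b + (-1) ^ b * X ^ (a - 1) + (-1) ^ a * X ^ (b - 1)

theorem trace_burauBlock {a b : ℕ} (ha : 0 < a) (hb : 0 < b) :
    Polynomial.C ((-1 : ℤ) ^ (a + b)) * (burauBlock a b).trace = oneBlockPoly a b := by
  obtain ⟨a, rfl⟩ := Nat.exists_eq_succ_of_ne_zero ha.ne'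
  obtain ⟨b, rfl⟩ := Nat.exists_eq_succ_of_ne_zero hb.ne'
  have h₁ : ((-1 : ℤ[X]) ^ a) * (-1) ^ a = 1 := by rw [← mul_pow]; simp
  have h₂ : ((-1 : ℤ[X]) ^ b) * (-1) ^ b = 1 := by rw [← mul_pow]; simp
  rw [map_pow, map_neg, map_one]
  simp only [burauBlock, Matrix.trace_fin_two_of, oneBlockPoly, negGeom, Nat.succ_eq_add_one,
    Nat.add_sub_cancel, neg_pow (X : ℤ[X]), pow_succ, pow_add]
  linear_combination (altPoly (a + 1) * altPoly (b + 1) * (-1) ^ b * (-1) ^ b - (-1) ^ b * X ^ a) * h₁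
    + (altPoly (a + 1) * altPoly (b + 1) - (-1) ^ a * X ^ b) * h₂

theorem oneBlockPoly_comm (a b : ℕ) : oneBlockPoly a b = oneBlockPoly b a := by
  unfold oneBlockPoly
  ring

theorem altPoly_one : altPoly 1 = 1 := by simp [altPoly]

theorem oneBlockPoly_one_one : oneBlockPoly 1 1 = -1 := by
  simp [oneBlockPoly, altPoly_one]

theorem oneBlockPoly_one (m : ℕ) : oneBlockPoly 1 (m + 2) = -(X * altPoly m) := by
  have h₁ := altPoly_succ (m + 1)
  have h₂ := altPoly_succ' m
  rw [map_pow, map_neg, map_one] at h₂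
  simp only [oneBlockPoly, altPoly_one, show m + 2 - 1 = m + 1 by omega,
    Nat.sub_self, pow_zero, pow_one, mul_one]
  linear_combination h₁ - h₂

/-- In the defining formula the two monomials have signs opposite to those of the product. Splitting
off constant and leading terms of the A's absorbs them: here all summands agree in sign in each
degree. -/
theorem oneBlockPoly_add_two (m n : ℕ) :
    oneBlockPoly (m + 2) (n + 2) = Polynomial.C ((-1 : ℤ) ^ (m + 2 + (n + 2)))
      + Polynomial.C ((-1 : ℤ) ^ (n + 2)) * X * altPoly m
      + Polynomial.C ((-1 : ℤ) ^ (m + 2)) * X * altPoly n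
      + X ^ 2 * altPoly (m + 1) * altPoly (n + 1) := by
  have h₁ := altPoly_succ' (m + 1)
  have h₂ := altPoly_succ' (n + 1)
  have h₃ := altPoly_succ m
  have h₄ := altPoly_succ n
  simp only [map_pow, map_neg, map_one] at *
  rw [oneBlockPoly, h₁, h₂, show m + 2 - 1 = m + 1 by omega, show n + 2 - 1 = n + 1 by omega]
  simp only [pow_succ, pow_add]
  linear_combination -(-1) ^ n * X * h₃ - (-1) ^ m * X * h₄

theorem coeff_altPoly (m j : ℕ) :
    (-1) ^ j * (altPoly m).coeff j = if j < m then (-1) ^ (m + 1) else 0 := by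
  induction m with
  | zero => simp [altPoly]
  | succ m ih =>
    rw [altPoly_succ, coeff_sub, mul_sub, ih, coeff_X_pow]
    rcases lt_trichotomy j m with h | rfl | h
    · rw [if_neg h.ne, if_pos h, if_pos (by omega)]
      ring
    · rw [if_pos rfl, if_neg (by omega), if_pos (by omega)]
      ring
    · rw [if_neg h.ne', if_neg (by omega), if_neg (by omega)]
      ring

/-- Up to sign, the coefficient counts the pairs of exponents, at most m and n, with sum j. -/
theorem coeff_altPoly_mul (m n j : ℕ) :
    0 ≤ (-1) ^ (j + m + n) * (altPoly (m + 1) * altPoly (n + 1)).coeff j ∧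
    (j ≤ m + n → 0 < (-1) ^ (j + m + n) * (altPoly (m + 1) * altPoly (n + 1)).coeff j) := by
  have h : (-1) ^ (j + m + n) * (altPoly (m + 1) * altPoly (n + 1)).coeff j =
      ∑ x ∈ Finset.HasAntidiagonal.antidiagonal j, if x.1 < m + 1 ∧ x.2 < n + 1 then (1 : ℤ) else 0 := by
    rw [coeff_mul, Finset.mul_sum]
    refine Finset.sum_congr rfl fun x hx => ?_
    have h₁ := coeff_altPoly (m + 1) x.1
    have h₂ := coeff_altPoly (n + 1) x.2
    have h₃ : ((-1 : ℤ) ^ m) * (-1) ^ m = 1 := by rw [← mul_pow]; simp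
    have h₄ : ((-1 : ℤ) ^ n) * (-1) ^ n = 1 := by rw [← mul_pow]; simp
    calc _ = (-1) ^ m * (-1) ^ n * (((-1) ^ x.1 * (altPoly (m + 1)).coeff x.1) *
          ((-1) ^ x.2 * (altPoly (n + 1)).coeff x.2)) := by
          rw [← Finset.HasAntidiagonal.mem_antidiagonal.1 hx]
          ring
      _ = _ := by
          rw [h₁, h₂, ite_and]
          split_ifs
          · simp only [pow_succ]
            linear_combination (-1) ^ n * (-1) ^ n * h₃ + h₄
          all_goals simp
  rw [h]
  refine ⟨Finset.sum_nonneg fun x _ => by split_ifs <;> simp, fun hj => ?_⟩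
  -- One admissible pair suffices: the first exponent is taken as large as possible.
  refine Finset.sum_pos' (fun x _ => by split_ifs <;> simp)
    ⟨(min j m, j - min j m), by simp, ?_⟩
  rw [if_pos ⟨by omega, by simp only; omega⟩]
  exact one_pos

/-- The excluded case m = n = 0, j = 1 is the gap in 1 + t², the polynomial of σ₁²σ₂². -/
theorem coeff_oneBlockPoly_add_two (m n j : ℕ) :
    0 ≤ (-1) ^ (j + (m + 2 + (n + 2))) * (oneBlockPoly (m + 2) (n + 2)).coeff j ∧
    (¬ (m = 0 ∧ n = 0) ∨ j ≠ 1 → j ≤ m + n + 2 →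
      0 < (-1) ^ (j + (m + 2 + (n + 2))) * (oneBlockPoly (m + 2) (n + 2)).coeff j) := by
  have h₃ : ((-1 : ℤ) ^ m) * (-1) ^ m = 1 := by rw [← mul_pow]; simp
  have h₄ : ((-1 : ℤ) ^ n) * (-1) ^ n = 1 := by rw [← mul_pow]; simp
  cases j with
  | zero =>
    have h : (-1) ^ (0 + (m + 2 + (n + 2))) * (oneBlockPoly (m + 2) (n + 2)).coeff 0 = 1 := by
      rw [oneBlockPoly_add_two]
      simp only [coeff_add, mul_assoc, coeff_C_mul, coeff_C_zero, coeff_X_mul_zero, pow_two X,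
        pow_add]
      linear_combination (-1) ^ n * (-1) ^ n * h₃ + h₄
    rw [h]
    exact ⟨zero_le_one, fun _ _ => one_pos⟩
  | succ k =>
    have h₁ := coeff_altPoly m k
    have h₂ := coeff_altPoly n k
    have h : (-1) ^ (k + 1 + (m + 2 + (n + 2))) * (oneBlockPoly (m + 2) (n + 2)).coeff (k + 1) =
        (if k < m then 1 else 0) + (if k < n then 1 else 0) +
        (-1) ^ (k + 1 + m + n) * (X * (altPoly (m + 1) * altPoly (n + 1))).coeff k := by
      have h₁' : (-1 : ℤ) ^ (m + 1) * (if k < m then (-1) ^ (m + 1) else 0) =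
          if k < m then 1 else 0 := by
        split_ifs
        · rw [← mul_pow]; simp
        · simp
      have h₂' : (-1 : ℤ) ^ (n + 1) * (if k < n then (-1) ^ (n + 1) else 0) =
          if k < n then 1 else 0 := by
        split_ifs
        · rw [← mul_pow]; simp
        · simp
      rw [oneBlockPoly_add_two, ← h₁', ← h₂', ← h₁, ← h₂]
      simp only [coeff_add, mul_assoc, coeff_C_mul, coeff_C_succ, coeff_X_mul, pow_two X, pow_add]
      linear_combination -(-1) ^ k * (-1) ^ m * (altPoly m).coeff k * h₄
        - (-1) ^ k * (-1) ^ n * (altPoly n).coeff k * h₃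
    rw [h]
    -- The product term starts in degree 2, so the coefficient of t comes only from the two linear
    -- terms and needs m or n positive.
    cases k with
    | zero =>
      rw [coeff_X_mul_zero]
      refine ⟨by split_ifs <;> simp, fun hmn _ => ?_⟩
      have : 0 < m ∨ 0 < n := by omega
      split_ifs <;> omega
    | succ i =>
      have h₅ := coeff_altPoly_mul m n i
      rw [coeff_X_mul, show (-1 : ℤ) ^ (i + 1 + 1 + m + n) = (-1) ^ (i + m + n) by ring]
      refine ⟨add_nonneg (by split_ifs <;> simp) h₅.1, fun _ hj => ?_⟩
      exact add_pos_of_nonneg_of_pos (by split_ifs <;> simp) (h₅.2 (by omega))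

theorem natDegree_altPoly_succ (m : ℕ) : (altPoly (m + 1)).natDegree = m := by
  refine natDegree_eq_of_le_of_coeff_ne_zero (natDegree_le_iff_coeff_eq_zero.2 fun j hj => ?_) ?_
  · have h := coeff_altPoly (m + 1) j
    rw [if_neg (by omega)] at h
    exact (mul_eq_zero.1 h).resolve_left (pow_ne_zero _ (by simp))
  · intro h₀
    have h := coeff_altPoly (m + 1) m
    rw [if_pos (by omega), h₀, mul_zero] at h
    exact pow_ne_zero _ (by simp) h.symm

theorem natDegree_oneBlockPoly_add_two (m n : ℕ) :
    (oneBlockPoly (m + 2) (n + 2)).natDegree = m + n + 2 := by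
  refine natDegree_eq_of_le_of_coeff_ne_zero ?_ ?_
  · have hle : ∀ k, (altPoly k).natDegree ≤ k - 1 := fun k => by
      cases k with
      | zero => simp [altPoly]
      | succ k => exact (natDegree_altPoly_succ k).le
    rw [oneBlockPoly]
    have hX : ∀ (i k : ℕ), ((-1) ^ i * X ^ k : ℤ[X]).natDegree ≤ k := fun i k => by
      rw [show ((-1) ^ i : ℤ[X]) = Polynomial.C ((-1) ^ i) by simp]
      exact natDegree_C_mul_X_pow_le _ _
    refine natDegree_add_le_of_degree_le (natDegree_add_le_of_degree_le ?_ ?_) ?_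
    · exact natDegree_mul_le.trans (by have := hle (m + 2); have := hle (n + 2); omega)
    · exact (hX _ _).trans (by omega)
    · exact (hX _ _).trans (by omega)
  · intro h
    have := (coeff_oneBlockPoly_add_two m n (m + n + 2)).2 (by omega) le_rfl
    rw [h, mul_zero] at this
    exact lt_irrefl _ this

theorem coeff_neg_X_mul_altPoly (m j : ℕ) :
    (-1) ^ (j + (m + 3)) * (-(X * altPoly m)).coeff j = if 1 ≤ j ∧ j ≤ m then 1 else 0 := by
  cases j with
  | zero => simp
  | succ j =>
    have h := coeff_altPoly m j
    have h₃ : ((-1 : ℤ) ^ m) * (-1) ^ m = 1 := by rw [← mul_pow]; simp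
    rw [coeff_neg, coeff_X_mul]
    simp only [pow_add]
    split_ifs with hj
    · rw [if_pos (by omega), pow_succ] at h
      linear_combination -(-1) ^ m * h + h₃
    · rw [if_neg (by omega)] at h
      linear_combination -(-1) ^ m * h

theorem natDegree_neg_X_mul_altPoly (m : ℕ) :
    (-(X * altPoly (m + 1))).natDegree = m + 1 := by
  have h := natDegree_altPoly_succ m
  have h₀ : altPoly (m + 1) ≠ 0 := by
    intro h₀
    have := coeff_altPoly (m + 1) 0
    rw [if_pos (by omega), h₀, coeff_zero, mul_zero] at this
    exact pow_ne_zero _ (by simp) this.symm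
  rw [natDegree_neg, natDegree_X_mul h₀, h]

end OneBlock

/-! ### Case distinction for a single block -/

section OneBlockCases

theorem oneBlockPoly_one_add_three (m : ℕ) :
    IsAlternating (oneBlockPoly 1 (m + 3)) ∧ (oneBlockPoly 1 (m + 3)).natDegree = m + 1 ∧
      ∀ j, (oneBlockPoly 1 (m + 3)).coeff j ≠ 0 →
        ((oneBlockPoly 1 (m + 3)).coeff j).sign = (-1) ^ (j + (m + 4)) := by
  rw [oneBlockPoly_one (m + 1)]
  have h := coeff_neg_X_mul_altPoly (m + 1)
  have hd := natDegree_neg_X_mul_altPoly m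
  refine ⟨isAlternating_of_forall_sign (w := m + 4) (lo := 1) (hi := m + 1) (by omega)
    (fun j h₁ h₂ => ?_) (fun j hj => ?_) hd.le, hd, fun j => sign_eq_of_nonneg ?_⟩
  · rw [h, if_pos ⟨h₁, h₂⟩]
    exact one_pos
  · obtain rfl : j = 0 := by omega
    simp
  · rw [h]
    split_ifs <;> simp

theorem oneBlockPoly_add_two_sign (m n j : ℕ) (hj : (oneBlockPoly (m + 2) (n + 2)).coeff j ≠ 0) :
    ((oneBlockPoly (m + 2) (n + 2)).coeff j).sign = (-1) ^ (j + (m + 2 + (n + 2))) :=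
  sign_eq_of_nonneg (coeff_oneBlockPoly_add_two m n j).1 hj

theorem isAlternating_oneBlockPoly_add_two {m n : ℕ} (h : ¬ (m = 0 ∧ n = 0)) :
    IsAlternating (oneBlockPoly (m + 2) (n + 2)) :=
  isAlternating_of_forall_sign (Nat.zero_le _)
    (fun j _ hj => (coeff_oneBlockPoly_add_two m n j).2 (Or.inl h) hj)
    (fun _ hj => absurd hj (Nat.not_lt_zero _)) (natDegree_oneBlockPoly_add_two m n).le

theorem oneBlockPoly_add_two_ne_zero (m n : ℕ) : oneBlockPoly (m + 2) (n + 2) ≠ 0 := by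
  intro h
  have := natDegree_oneBlockPoly_add_two m n
  rw [h, natDegree_zero] at this
  omega

theorem isAlternating_neg_one : IsAlternating (-1) :=
  ⟨by simp, fun j _ h => by simp at h⟩

/-- The description of `V**` for a word with one block `σ₁ ^ a σ₂ ^ b`. -/
theorem oneBlockPoly_spec {a b : ℕ} (ha : 0 < a) (hb : 0 < b) :
    (¬ (a = 2 ∧ b = 2) → oneBlockPoly a b = 0 ∨ IsAlternating (oneBlockPoly a b)) ∧
    (oneBlockPoly a b = 0 ↔ (a = 1 ∧ b = 2) ∨ (a = 2 ∧ b = 1)) ∧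
    ((oneBlockPoly a b ≠ 0 ∧ ((oneBlockPoly a b).natDegree : ℤ) = ((a + b : ℕ) : ℤ) - 3) ↔
      min a b = 1 ∧ 3 ≤ max a b) ∧
    (min a b = 1 ∧ 3 ≤ max a b → oneBlockPoly a b = -(X * altPoly (a + b - 3))) ∧
    ((oneBlockPoly a b ≠ 0 ∧ ((oneBlockPoly a b).natDegree : ℤ) = ((a + b : ℕ) : ℤ) - 2) ↔
      (a = 1 ∧ b = 1) ∨ (2 ≤ a ∧ 2 ≤ b)) ∧
    (a = 1 ∧ b = 1 → oneBlockPoly a b = -1) ∧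
    (2 ≤ a ∧ 2 ≤ b → oneBlockPoly a b = Polynomial.C ((-1 : ℤ) ^ (a + b))
      + Polynomial.C ((-1 : ℤ) ^ b) * X * altPoly (a - 2)
      + Polynomial.C ((-1 : ℤ) ^ a) * X * altPoly (b - 2)
      + X ^ 2 * altPoly (a - 1) * altPoly (b - 1)) ∧
    (4 ≤ a + b → ∀ j : ℕ, (oneBlockPoly a b).coeff j ≠ 0 →
      ((oneBlockPoly a b).coeff j).sign = (-1) ^ (j + (a + b))) := by
  obtain ⟨rfl, rfl⟩ | h | h | ⟨ha₂, hb₂⟩ : (a = 1 ∧ b = 1) ∨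
      ((a = 1 ∧ b = 2) ∨ (a = 2 ∧ b = 1)) ∨ ((a = 1 ∧ 3 ≤ b) ∨ (b = 1 ∧ 3 ≤ a)) ∨
      (2 ≤ a ∧ 2 ≤ b) := by omega
  · rw [oneBlockPoly_one_one]
    refine ⟨fun _ => Or.inr isAlternating_neg_one, by simp, by simp, by simp, by simp, by simp,
      by simp, by simp⟩
  · have h₀ : oneBlockPoly a b = 0 := by
      have h₁ : oneBlockPoly 1 2 = 0 := by rw [oneBlockPoly_one 0]; simp [altPoly]
      obtain ⟨rfl, rfl⟩ | ⟨rfl, rfl⟩ := h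
      · exact h₁
      · rw [oneBlockPoly_comm, h₁]
    rw [h₀]
    refine ⟨fun _ => Or.inl rfl, iff_of_true rfl h, iff_of_false (by simp) (by omega), by omega,
      iff_of_false (by simp) (by omega), by omega, by omega, by simp⟩
  -- Symmetry in a and b reduces both orders to a = 1.
  · obtain ⟨m, hw, hP⟩ : ∃ m, a + b = m + 4 ∧ oneBlockPoly a b = oneBlockPoly 1 (m + 3) := by
      obtain ⟨rfl, h₃⟩ | ⟨rfl, h₃⟩ := h <;> obtain ⟨m, rfl⟩ := Nat.exists_eq_add_of_le' h₃
      · exact ⟨m, by omega, rfl⟩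
      · exact ⟨m, by omega, oneBlockPoly_comm _ _⟩
    obtain ⟨halt, hd, hsign⟩ := oneBlockPoly_one_add_three m
    rw [hP, hw]
    refine ⟨fun _ => Or.inr halt, iff_of_false halt.1 (by omega),
      iff_of_true ⟨halt.1, ?_⟩ (by omega), fun _ => oneBlockPoly_one (m + 1),
      iff_of_false (fun h => ?_) (by omega), by omega, by omega, fun _ => hsign⟩
    · rw [hd]
      push_cast
      ring
    · have := h.2
      rw [hd] at this
      omega
  · obtain ⟨m, rfl⟩ := Nat.exists_eq_add_of_le' ha₂
    obtain ⟨n, rfl⟩ := Nat.exists_eq_add_of_le' hb₂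
    have hd := natDegree_oneBlockPoly_add_two m n
    have h₀ := oneBlockPoly_add_two_ne_zero m n
    refine ⟨fun h => Or.inr (isAlternating_oneBlockPoly_add_two (by omega)),
      iff_of_false h₀ (by omega), iff_of_false (fun h => ?_) (by omega), by omega,
      iff_of_true ⟨h₀, ?_⟩ (by omega), by omega, fun _ => oneBlockPoly_add_two m n,
      fun _ => oneBlockPoly_add_two_sign m n⟩
    · have := h.2
      rw [hd] at this
      omega
    · rw [hd]
      omega

end OneBlockCases

/-- The factorisation of the Jones polynomial from one of the trace of the Burau matrix. -/
theorem jones_eq_of_trace_burauProd_eq {β : BraidWord 2} (hβ : ∀ l ∈ β, l.positive = true)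
    {S : ℤ[X]} (hS : (burauProd β).trace = X * S) :
    jones β = T (2 * ((β.length : ℤ) - 2)) * inQuarterPower
      (Polynomial.C ((-1 : ℤ) ^ β.length) * (1 + X ^ 2) +
        X ^ 2 * (Polynomial.C ((-1 : ℤ) ^ β.length) * S)) := by
  have h₁ : (T (2 * (β.length : ℤ)) : ℤ[T;T⁻¹]) = T (2 * ((β.length : ℤ) - 2)) * T 4 := by
    rw [← T_add]
    congr 1
    ring
  have h₂ : (T 4 * T (-4) : ℤ[T;T⁻¹]) = 1 := by rw [← T_add, add_neg_cancel, T_zero]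
  rw [jones_eq_trace_burauProd β hβ, hS, inQuarterPower, h₁]
  simp only [map_add, map_mul, map_pow, map_neg, map_one, aeval_X]
  linear_combination (-1) ^ β.length * T (2 * ((β.length : ℤ) - 2)) * h₂

end ThreeBraidJones

end

/-! ### The proposition -/

open ThreeBraidJones in
theorem mainTheorem6 (r : ℕ) (hr : 1 ≤ r) (a b : Fin r → ℕ)
    (ha : ∀ j, 0 < a j) (hb : ∀ j, 0 < b j)
    (w : ℕ) (hw : (w : ℤ) = writhe (positiveWord a b)) :
    ∃ Vs Vss : ℤ[X],
      -- `V = t^{(w-2)/2} V*`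
      jones (positiveWord a b) = T (2 * ((w : ℤ) - 2)) * inQuarterPower Vs ∧
      Vs.natDegree ≤ w ∧
      Vs = Polynomial.C ((-1 : ℤ) ^ w) * (1 + X ^ 2) + X ^ 2 * Vss ∧
      -- the symmetry, as an identity of Laurent polynomials in `t` (here `T 1` is `t`),
      -- and for the coefficients
      LaurentPolynomial.C ((-1 : ℤ) ^ w) * T (w : ℤ) * invert (toLaurent Vss) =
        T 2 * toLaurent Vss ∧
      (∀ j : ℤ, (toLaurent Vss).coeff j = (-1) ^ w * (toLaurent Vss).coeff ((w : ℤ) - j - 2)) ∧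
      (r = 1 →
        let a₁ := a ⟨0, hr⟩
        let b₁ := b ⟨0, hr⟩
        (¬ (a₁ = 2 ∧ b₁ = 2) → Vss = 0 ∨ IsAlternating Vss) ∧
        (Vss = 0 ↔ ({a₁, b₁} : Set ℕ) = {1, 2}) ∧
        ((Vss ≠ 0 ∧ (Vss.natDegree : ℤ) = (w : ℤ) - 3) ↔ min a₁ b₁ = 1 ∧ 3 ≤ max a₁ b₁) ∧
        (min a₁ b₁ = 1 ∧ 3 ≤ max a₁ b₁ → Vss = -(X * altPoly (w - 3))) ∧
        ((Vss ≠ 0 ∧ (Vss.natDegree : ℤ) = (w : ℤ) - 2) ↔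
          (a₁ = 1 ∧ b₁ = 1) ∨ (2 ≤ a₁ ∧ 2 ≤ b₁)) ∧
        (a₁ = 1 ∧ b₁ = 1 → Vss = -1) ∧
        (2 ≤ a₁ ∧ 2 ≤ b₁ →
          Vss = Polynomial.C ((-1 : ℤ) ^ w)
            + Polynomial.C ((-1 : ℤ) ^ b₁) * X * altPoly (a₁ - 2)
            + Polynomial.C ((-1 : ℤ) ^ a₁) * X * altPoly (b₁ - 2)
            + X ^ 2 * altPoly (a₁ - 1) * altPoly (b₁ - 1)) ∧
        (4 ≤ w → ∀ j : ℕ, Vss.coeff j ≠ 0 → (Vss.coeff j).sign = (-1) ^ (j + w))) ∧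
      (2 ≤ r → Vss.natDegree ≤ w - 3) := by
  -- From here on `r` is the number of blocks minus one.
  obtain ⟨r, rfl⟩ := Nat.exists_eq_add_of_le' hr
  have hpos := positive_of_mem_positiveWord a b
  have hlen : (positiveWord a b).length = w := by
    rw [writhe_of_positive _ hpos] at hw
    exact_mod_cast hw.symm
  have hsum : w = ∑ j, (a j + b j) := by rw [← hlen, length_positiveWord]
  -- Of the r + 1 block factors X, one is split off to form X² V**; the other r remain in `S` and
  -- give the degree bound.
  set S : ℤ[X] := X ^ r * (List.ofFn fun j => burauBlock (a j) (b j)).prod.trace with hSdef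
  have hS : (burauProd (positiveWord a b)).trace = X * S := by
    rw [burauProd_positiveWord a b ha hb, Matrix.trace_smul, smul_eq_mul, hSdef]
    ring
  have hjones := jones_eq_of_trace_burauProd_eq hpos hS
  have hsymm₀ := symm_of_trace_burauProd_eq hS
  rw [hlen] at hjones hsymm₀
  have hsymm : LaurentPolynomial.C ((-1 : ℤ) ^ w) * T (w : ℤ) *
      invert (toLaurent (Polynomial.C ((-1 : ℤ) ^ w) * S)) =
        T 2 * toLaurent (Polynomial.C ((-1 : ℤ) ^ w) * S) := by
    rw [toLaurent_C_mul_eq, map_mul, invert_C, mul_left_comm, hsymm₀, mul_left_comm]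
  have hcoeff := coeff_symm_of_laurent_symm hsymm
  have hdvd : X ^ r ∣ Polynomial.C ((-1 : ℤ) ^ w) * S :=
    (Dvd.intro _ rfl).mul_left _
  have hdeg := natDegree_le_of_coeff_symm hdvd hcoeff
  have hw₂ : 2 ≤ w := by
    rw [hsum, Fin.sum_univ_succ]
    have := ha 0
    have := hb 0
    omega
  refine ⟨_, Polynomial.C ((-1 : ℤ) ^ w) * S, hjones, ?_, rfl,
    hsymm, hcoeff, fun hr₁ => ?_, fun hr₂ => hdeg.trans (by omega)⟩
  · refine natDegree_add_le_of_degree_le ?_ ?_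
    · refine (natDegree_C_mul_le _ _).trans (natDegree_add_le_of_degree_le (by simp) ?_)
      exact (natDegree_X_pow_le 2).trans hw₂
    · refine natDegree_mul_le.trans ?_
      rw [natDegree_X_pow]
      omega
  · obtain rfl : r = 0 := by omega
    have hw₁ : w = a 0 + b 0 := by simp [hsum]
    have hP : Polynomial.C ((-1 : ℤ) ^ w) * S = oneBlockPoly (a 0) (b 0) := by
      rw [← trace_burauBlock (ha 0) (hb 0), hSdef, hw₁]
      simp
    rw [hP, hw₁]
    intro a₁ b₁
    rw [Set.pair_eq_pair_iff]
    exact oneBlockPoly_spec (ha 0) (hb 0)
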